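/- Let $b\ge 2$ be an integer and $\omega_b=\exp(2\pi\sqrt{-1}/b)$. Let $k\ge 1$ be an integer with $b$-adic expansion $k=\kappa_1b^{a_1-1}+\cdots+\kappa_vb^{a_v-1}$, where $0<\kappa_i\le b-1$ and $a_1>\cdots>a_v\ge 1$. For $x\in[0,1)$ with $b$-adic expansion $x=\xi_1b^{-1}+\xi_2b^{-2}+\cdots$ (with infinitely many digits $\xi_i\neq b-1$) let $\mathrm{wal}_k(x)=\omega_b^{\sum_{i=1}^v\kappa_i\xi_{a_i}}$ be the $k$-th $b$-adic Walsh function, and let $\widehat f(k)=\int_0^1 f(x)\overline{\mathrm{wal}_k(x)}\,dx$. Put $$m_b=\min_{1\le c\le b-1}|1-\overline{\omega_b}^{\,c}|,\qquad M_b=\max_{1\le c\le b-1}|1-\overline{\omega_b}^{\,c}|,$$ and, for an integer $\alpha\ge 1$, $$\mu_{\alpha,\mathrm{per}}(k)=\begin{cases}a_1+\cdots+a_v+(\alpha-v)a_v & \text{if } v\le\alpha,\\ a_1+\cdots+a_\alpha & \text{if } v\ge\alpha.\end{cases}$$ Theorem. Let $\alpha$ and $k$ be positive integers. Let $f\colon[0,1]\to\mathbb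 R$ be such that $f^{(i)}$ is absolutely continuous and $\int_0^1 f^{(i)}(x)\,dx=0$ for all $0\le i<\alpha$, and $f^{(\alpha)}\in L^2[0,1]$. If $b>2$, then $$|\widehat f(k)|\le \int_0^1|f^{(\alpha)}(x)|\,dx\;\frac{b^{-\mu_{\alpha,\mathrm{per}}(k)}}{m_b^{\alpha}}\,M_b\left(1+\frac{b\,m_b}{b-M_b}\left(1-\left(\frac{M_b}{b}\right)^{v}\right)\right).$$ If $b=2$, then $$|\widehat f(k)|\le \int_0^1|f^{(\alpha)}(x)|\,dx\;\frac{2^{-\mu_{\alpha,\mathrm{per}}(k)}}{2^{\alpha-1}}.$$ -/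

import Mathlib

open MeasureTheory Set
open scoped ComplexConjugate

noncomputable section

namespace Walsh

/-- The digit of `k` in base `b` that multiplies `b ^ (a - 1)` (for `a ≥ 1`). -/
def natDigit (b k a : ℕ) : ℕ := (Nat.digits b k).getD (a - 1) 0

/-- The set `{a_1, …, a_v}` of the positions (counted from `1`) of the nonzero digits in the
`b`-adic expansion `k = κ_1 b ^ (a_1 - 1) + ⋯ + κ_v b ^ (a_v - 1)`. -/
def positions (b k : ℕ) : Finset ℕ :=
  (Finset.Icc 1 (Nat.digits b k).length).filter fun a => natDigit b k a ≠ 0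

/-- The number `v` of nonzero `b`-adic digits of `k`. -/
def hammingWeight (b k : ℕ) : ℕ := (positions b k).card

/-- `position b k i` is `a_i`, for `1 ≤ i ≤ v`, where `a_1 > a_2 > ⋯ > a_v ≥ 1`. -/
def position (b k i : ℕ) : ℕ := ((positions b k).sort (· ≥ ·)).getD (i - 1) 0

/-- The quantity `μ_{α,per}(k)` in base `b`. -/
def muPer (b α k : ℕ) : ℕ :=
  if k = 0 then 0
  else if hammingWeight b k ≤ α then
    (∑ i ∈ Finset.Icc 1 (hammingWeight b k), position b k i)
      + (α - hammingWeight b k) * position b k (hammingWeight b k)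
  else ∑ i ∈ Finset.Icc 1 α, position b k i

/-- `ω_b = exp (2 π i / b)`. -/
def omega (b : ℕ) : ℂ := Complex.exp (2 * Real.pi * Complex.I / b)

/-- The digit `ξ_a` (for `a ≥ 1`) of `x = ξ_1 b⁻¹ + ξ_2 b⁻² + ⋯ ∈ [0, 1)`, for the expansion in
which infinitely many digits differ from `b - 1`. -/
def realDigit (b : ℕ) (x : ℝ) (a : ℕ) : ℕ := ⌊x * (b : ℝ) ^ a⌋₊ % b

/-- The `k`-th `b`-adic Walsh function, for `x ∈ [0, 1)`. -/
def wal (b k : ℕ) (x : ℝ) : ℂ :=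
  omega b ^ ∑ a ∈ positions b k, natDigit b k a * realDigit b x a

/-- The `k`-th `b`-adic Walsh coefficient of `f : [0, 1) → ℂ`. -/
def coeff (b k : ℕ) (f : ℝ → ℂ) : ℂ :=
  ∫ x in Ico (0 : ℝ) 1, f x * conj (wal b k x)

/-- `m_b`, the minimum over `1 ≤ c ≤ b - 1` of `|1 - conj ω_b ^ c|`. -/
def mConst (b : ℕ) : ℝ :=
  sInf ((fun c : ℕ => ‖1 - conj (omega b) ^ c‖) '' Icc 1 (b - 1))

/-- `M_b`, the maximum over `1 ≤ c ≤ b - 1` of `|1 - conj ω_b ^ c|`. -/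
def MConst (b : ℕ) : ℝ :=
  sSup ((fun c : ℕ => ‖1 - conj (omega b) ^ c‖) '' Icc 1 (b - 1))

/-- The `i`-th derivative `f⁽ⁱ⁾` on `[0, 1]`, one-sided at the end points.  Only the values of `f`
on `[0, 1]` matter for its values there. -/
def der (i : ℕ) (f : ℝ → ℝ) : ℝ → ℝ := iteratedDerivWithin i f (Icc 0 1)

/-- The Sobolev space of the functions `f : [0, 1] → ℝ` such that `f⁽ⁱ⁾` is absolutely continuous
for `0 ≤ i < α`, and `f⁽ᵅ⁾`, which then exists almost everywhere, is in `L²[0, 1]`. -/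
structure IsSobolev (α : ℕ) (f : ℝ → ℝ) : Prop where
  absolutelyContinuous : ∀ i < α, AbsolutelyContinuousOnInterval (der i f) 0 1
  memLp : MemLp (der α f) 2 (volume.restrict (Icc 0 1))

/-- The periodic Sobolev space: in addition, `∫₀¹ f⁽ⁱ⁾ = 0` for `0 ≤ i < α`. -/
structure IsSobolevPer (α : ℕ) (f : ℝ → ℝ) : Prop extends IsSobolev α f where
  integral_eq_zero : ∀ i < α, ∫ x in (0 : ℝ)..1, der i f x = 0

end Walsh

end

/-! Write K for the conjugate of wal_k. Since f⁽ⁱ⁾ has mean zero for i < α, subtracting a constant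
from the other factor costs nothing. Integration by parts against the primitive of K minus its mean
therefore has no boundary terms. Repeating this α times gives |∫ f K| = |∫ f⁽ᵅ⁾ `prim`^[α] K|, and
the theorem reduces to a sup bound for `prim`^[α] K (`norm_integral_mul_le`).

K is a product of step characters z ^ ⌊x bᵃ⌋ over the positions a of the nonzero digits, with z ≠ 1
a b-th root of unity. The primitive is formed from the finest level to the coarsest. A function that
gains a factor z under a shift by b^(-a) has mean zero over every b^(1-a)-interval. All coarser
characters are constant on the cells of that length, so they come out of the integral
(`integral_cellConst_mul`, `prim_stepChar_mul`). After each step the function is (μ + F) times the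
characters not yet used, with μ constant and F continuous and quasi-periodic at the level just
treated. The next step multiplies this by one more character (`exists_step`). Once no character is
left, taking the primitive removes μ and keeps the level of F, so the last level repeats. Each
primitive contributes the cell length of its level, and the product of these lengths is
b^(-μ_{α,per}(k)).

For the constants, a quasi-periodic primitive costs 1/m_b and the primitive starting at 0 costs
M_b/m_b. The relative size of F obeys G(i+1) = 1 + (M_b/b) G(i), because the levels differ by at
least a factor b; this produces the geometric sum (`norm_iterate_prim_charProd_le`). For b = 2 the
only multiplier is -1, and a sharper invariant holds: μ + F is real with values in [0, 2μ]
(`exists_binary_step`). No geometric sum then appears. -/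

noncomputable section

namespace Walsh

/-! ### Step characters and quasi-periodic functions -/

/-- The step function `x ↦ z ^ ⌊x / L⌋`. -/
def stepChar (z : ℂ) (L x : ℝ) : ℂ := z ^ ⌊x / L⌋

/-- Quasi-periodicity with period `L` and multiplier `z`. -/
def QuasiPeriodic (L : ℝ) (z : ℂ) (F : ℝ → ℂ) : Prop := ∀ x, F (x + L) = z * F x

/-- Integrability on every bounded interval. -/
def LocInt (F : ℝ → ℂ) : Prop := ∀ s t, IntervalIntegrable F volume s t

/-- Constancy on every half-open interval `[n L, (n + 1) L)`. -/
def CellConst (L : ℝ) (h : ℝ → ℂ) : Prop := ∀ x y, ⌊x / L⌋ = ⌊y / L⌋ → h x = h y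

theorem stepChar_cellConst (z : ℂ) (L : ℝ) : CellConst L (stepChar z L) := by
  intro x y h
  simp [stepChar, h]

theorem stepChar_quasiPeriodic {z : ℂ} (hz : z ≠ 0) {L : ℝ} (hL : 0 < L) :
    QuasiPeriodic L z (stepChar z L) := by
  intro x
  have : (x + L) / L = x / L + 1 := by field_simp
  simp only [stepChar, this, Int.floor_add_one]
  rw [zpow_add₀ hz, zpow_one, mul_comm]

theorem stepChar_eq_one (z : ℂ) {L x : ℝ} (h0 : 0 ≤ x) (h1 : x < L) : stepChar z L x = 1 := by
  have hL : 0 < L := h0.trans_lt h1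
  have : ⌊x / L⌋ = 0 := by
    rw [Int.floor_eq_zero_iff]
    exact ⟨by positivity, by rwa [div_lt_one hL]⟩
  simp [stepChar, this]

theorem norm_stepChar {z : ℂ} (hz : ‖z‖ = 1) (L x : ℝ) : ‖stepChar z L x‖ = 1 := by
  simp [stepChar, norm_zpow, hz]

theorem measurable_stepChar (z : ℂ) (L : ℝ) : Measurable (stepChar z L) :=
  (measurable_from_top (f := fun n : ℤ => z ^ n)).comp
    (Int.measurable_floor.comp (measurable_id.div_const L))

theorem LocInt.bdd_mul {F h : ℝ → ℂ} (hF : LocInt F) (hm : Measurable h) {C : ℝ}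
    (hC : ∀ x, ‖h x‖ ≤ C) : LocInt fun x => h x * F x := by
  intro s t
  have := hF s t
  rw [intervalIntegrable_iff] at this ⊢
  exact this.bdd_mul hm.aestronglyMeasurable (Filter.Eventually.of_forall hC)

theorem integral_zsmul_eq_zero {F : ℝ → ℂ} (hF : LocInt F) {L : ℝ}
    (h0 : ∀ s : ℤ, ∫ x in (s * L)..(s * L + L), F x = 0) (n : ℤ) :
    ∫ x in (0 : ℝ)..(n * L), F x = 0 := by
  induction n using Int.induction_on with
  | zero => simp
  | succ n ih =>
    rw [← intervalIntegral.integral_add_adjacent_intervals (hF 0 ((n : ℤ) * L)) (hF _ _), ih,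
      zero_add]
    convert h0 n using 2
    push_cast; ring
  | pred n ih =>
    have := h0 (-(n : ℤ) - 1)
    have e : (((-(n : ℤ) - 1 : ℤ) : ℝ) * L + L) = ((-(n : ℤ) : ℤ) : ℝ) * L := by push_cast; ring
    rw [e] at this
    rw [← intervalIntegral.integral_add_adjacent_intervals (hF 0 (((-(n : ℤ) - 1 : ℤ) : ℝ) * L))
      (hF _ _), this, add_zero] at ih
    exact ih

theorem floor_div_eq {L : ℝ} (hL : 0 < L) {n : ℤ} {x : ℝ} (h0 : n * L ≤ x) (h1 : x < n * L + L) :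
    ⌊x / L⌋ = n := by
  rw [Int.floor_eq_iff, le_div_iff₀ hL, div_lt_iff₀ hL]
  exact ⟨h0, by linarith⟩

theorem floor_mul_le {L : ℝ} (hL : 0 < L) (x : ℝ) : ⌊x / L⌋ * L ≤ x := by
  have := Int.floor_le (x / L)
  rwa [le_div_iff₀ hL] at this

theorem lt_floor_mul_add {L : ℝ} (hL : 0 < L) (x : ℝ) : x < ⌊x / L⌋ * L + L := by
  have := Int.lt_floor_add_one (x / L)
  rw [div_lt_iff₀ hL] at this
  linarith

/-- A factor that is constant on cells on which `F` has mean zero can be taken out of the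
primitive of `F`. -/
theorem integral_cellConst_mul {F h : ℝ → ℂ} (hF : LocInt F) (hhF : LocInt fun x => h x * F x)
    {L : ℝ} (hL : 0 < L) (hh : CellConst L h)
    (h0 : ∀ s : ℝ, ∫ x in s..(s + L), F x = 0) (x : ℝ) :
    ∫ t in (0 : ℝ)..x, h t * F t = h x * ∫ t in (0 : ℝ)..x, F t := by
  have key : ∀ s : ℤ, ∫ x in (s * L)..(s * L + L), h x * F x = 0 := by
    intro s
    have : ∫ x in (s * L)..(s * L + L), h x * F x
        = ∫ x in (s * L)..(s * L + L), h (s * L) * F x := by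
      apply intervalIntegral.integral_congr_ae
      have : ∀ᵐ y : ℝ, y ≠ s * L + L := by
        simp [ae_iff]
      filter_upwards [this] with y hy hmem
      rw [uIoc_of_le (by linarith)] at hmem
      congr 1
      apply hh
      rw [floor_div_eq hL (n := s) hmem.1.le (lt_of_le_of_ne hmem.2 hy),
        floor_div_eq hL (n := s) le_rfl (by linarith)]
    rw [this, intervalIntegral.integral_const_mul, h0, mul_zero]
  set n := ⌊x / L⌋
  rw [← intervalIntegral.integral_add_adjacent_intervals (hhF 0 (n * L)) (hhF _ x),
    ← intervalIntegral.integral_add_adjacent_intervals (hF 0 (n * L)) (hF _ x),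
    integral_zsmul_eq_zero hhF key, integral_zsmul_eq_zero hF (fun s => h0 _), zero_add, zero_add,
    ← intervalIntegral.integral_const_mul]
  apply intervalIntegral.integral_congr
  intro y hy
  rw [uIcc_of_le (floor_mul_le hL x)] at hy
  simp only
  congr 1
  apply hh
  rw [floor_div_eq hL (n := n) hy.1 (hy.2.trans_lt (lt_floor_mul_add hL x))]

namespace QuasiPeriodic

variable {L : ℝ} {z : ℂ} {F H : ℝ → ℂ}

theorem nat_mul (hF : QuasiPeriodic L z F) (n : ℕ) (x : ℝ) : F (x + n * L) = z ^ n * F x := by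
  induction n with
  | zero => simp
  | succ n ih =>
    have : x + (n + 1 : ℕ) * L = (x + n * L) + L := by push_cast; ring
    rw [this, hF, ih, pow_succ]; ring

theorem int_mul (hF : QuasiPeriodic L z F) (hz : z ≠ 0) (n : ℤ) (x : ℝ) :
    F (x + n * L) = z ^ n * F x := by
  induction n using Int.induction_on generalizing x with
  | zero => simp
  | succ n ih =>
    have : x + ((n + 1 : ℤ) : ℝ) * L = (x + ((n : ℤ) : ℝ) * L) + L := by push_cast; ring
    rw [this, hF, ih, zpow_add₀ hz, zpow_one]; ring
  | pred n ih =>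
    have h1 := hF (x + ((-(n : ℤ) - 1 : ℤ) : ℝ) * L)
    have : x + ((-(n : ℤ) - 1 : ℤ) : ℝ) * L + L = x + ((-(n : ℤ) : ℤ) : ℝ) * L := by
      push_cast; ring
    rw [this, ih] at h1
    rw [zpow_sub₀ hz, zpow_one]
    field_simp
    rw [h1]
    ring

theorem periodic (hF : QuasiPeriodic L z F) {b : ℕ} (hb : z ^ b = 1) (n : ℕ) :
    Function.Periodic F (n * (b * L)) := by
  intro x
  have := hF.nat_mul (n * b) x
  rw [mul_comm n b, pow_mul, hb, one_pow, one_mul, mul_comm b n] at this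
  rw [← this]; push_cast; ring_nf

theorem integral_add (hF : QuasiPeriodic L z F) (s t : ℝ) :
    ∫ x in (s + L)..(t + L), F x = z * ∫ x in s..t, F x := by
  rw [← intervalIntegral.integral_comp_add_right, ← intervalIntegral.integral_const_mul]
  simp_rw [hF _]

/-- A shift by L multiplies the integral by z, while periodicity leaves it unchanged; as z ≠ 1, it
vanishes. -/
theorem integral_eq_zero (hF : QuasiPeriodic L z F) (hz : z ≠ 1) {b : ℕ} (hb : z ^ b = 1)
    (n : ℕ) (s : ℝ) : ∫ x in s..(s + n * (b * L)), F x = 0 := by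
  have hp := hF.periodic hb n
  have h1 := hp.intervalIntegral_add_eq s (s + L)
  have h2 := hF.integral_add s (s + n * (b * L))
  rw [show s + n * (b * L) + L = s + L + n * (b * L) by ring, ← h1] at h2
  have : (1 - z) * ∫ x in s..(s + n * (b * L)), F x = 0 := by
    linear_combination h2
  rcases mul_eq_zero.1 this with h | h
  · exact absurd (sub_eq_zero.1 h).symm hz
  · exact h

end QuasiPeriodic

/-! ### Primitives of quasi-periodic functions -/

/-- The quasi-periodic primitive of a quasi-periodic function. -/
def qpPrim (L : ℝ) (z : ℂ) (H : ℝ → ℂ) (x : ℝ) : ℂ :=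
  (∫ t in (0 : ℝ)..x, H t) - (1 - z)⁻¹ * ∫ t in (0 : ℝ)..L, H t

section
variable {L : ℝ} {z : ℂ} {H : ℝ → ℂ}

theorem qpPrim_quasiPeriodic (hH : QuasiPeriodic L z H) (hi : LocInt H) (hz : z ≠ 1) :
    QuasiPeriodic L z (qpPrim L z H) := by
  intro x
  have h1 : ∫ t in (0 : ℝ)..(x + L), H t
      = (∫ t in (0 : ℝ)..L, H t) + z * ∫ t in (0 : ℝ)..x, H t := by
    rw [← hH.integral_add, zero_add, intervalIntegral.integral_add_adjacent_intervals (hi _ _)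
      (hi _ _)]
  have h2 : 1 - z ≠ 0 := sub_ne_zero.2 hz.symm
  simp only [qpPrim, h1]
  field_simp
  ring

/-- The increment of the primitive P over a period is (z - 1) P(x) by quasi-periodicity. Only one
cell has to be integrated, whence the bound that follows. -/
theorem qpPrim_eq (hH : QuasiPeriodic L z H) (hi : LocInt H) (hz : z ≠ 1) (x : ℝ) :
    qpPrim L z H x = -((1 - z)⁻¹ * ∫ t in x..(x + L), H t) := by
  have h1 := qpPrim_quasiPeriodic hH hi hz x
  have h2 : qpPrim L z H (x + L) - qpPrim L z H x = ∫ t in x..(x + L), H t := by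
    simp only [qpPrim]
    rw [sub_sub_sub_cancel_right, intervalIntegral.integral_interval_sub_left (hi _ _) (hi _ _)]
  have h3 : 1 - z ≠ 0 := sub_ne_zero.2 hz.symm
  rw [← h2, h1]
  field_simp
  ring

theorem norm_qpPrim_le (hH : QuasiPeriodic L z H) (hi : LocInt H) (hz : z ≠ 1) (hL : 0 < L)
    {m B : ℝ} (hm : 0 < m) (hmz : m ≤ ‖1 - z‖) (hB : ∀ x, ‖H x‖ ≤ B) (x : ℝ) :
    ‖qpPrim L z H x‖ ≤ L * B / m := by
  have hB0 : 0 ≤ B := (norm_nonneg _).trans (hB 0)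
  have := intervalIntegral.norm_integral_le_of_norm_le_const (a := x) (b := x + L)
    (f := H) (C := B) (fun t _ => hB t)
  rw [add_sub_cancel_left, abs_of_pos hL] at this
  rw [qpPrim_eq hH hi hz, norm_neg, norm_mul, norm_inv, div_eq_inv_mul]
  have h2 : ‖1 - z‖⁻¹ ≤ m⁻¹ := inv_anti₀ hm hmz
  calc _ ≤ m⁻¹ * (B * L) := mul_le_mul h2 this (norm_nonneg _) (by positivity)
    _ = _ := by ring

/-- For n ≥ 0, each cell is cut at the translate of y and the two kinds of pieces are summed as
geometric series in z, with n + 1 and n terms. Both coefficients are controlled by M, and the two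
pieces have total length L, so the bound below carries M/m without a further factor 2. -/
theorem integral_quasiPeriodic_eq (hH : QuasiPeriodic L z H) (hi : LocInt H) (hz : z ≠ 1)
    (hz0 : z ≠ 0) (n : ℤ) (y : ℝ) :
    ∫ t in (0 : ℝ)..(y + n * L), H t = (1 - z)⁻¹ * ((1 - z ^ (n + 1)) * (∫ t in (0 : ℝ)..y, H t)
      + (1 - z ^ n) * ∫ t in y..L, H t) := by
  have h1 : ∀ x, ∫ t in (0 : ℝ)..x, H t = qpPrim L z H x - qpPrim L z H 0 := by simp [qpPrim]
  have h2 : ∫ t in (0 : ℝ)..L, H t = (∫ t in (0 : ℝ)..y, H t) + ∫ t in y..L, H t :=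
    (intervalIntegral.integral_add_adjacent_intervals (hi _ _) (hi _ _)).symm
  have h3 : 1 - z ≠ 0 := sub_ne_zero.2 hz.symm
  rw [h1 (y + n * L), (qpPrim_quasiPeriodic hH hi hz).int_mul hz0]
  simp only [qpPrim, h2, intervalIntegral.integral_same, zpow_add₀ hz0, zpow_one]
  field_simp
  ring

theorem norm_integral_quasiPeriodic_le (hH : QuasiPeriodic L z H) (hi : LocInt H) (hz : z ≠ 1)
    (hz0 : z ≠ 0) (hL : 0 < L) {m M B : ℝ} (hm : 0 < m) (hmz : m ≤ ‖1 - z‖)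
    (hM : ∀ n : ℤ, ‖1 - z ^ n‖ ≤ M) (hB : ∀ x, ‖H x‖ ≤ B) (x : ℝ) :
    ‖∫ t in (0 : ℝ)..x, H t‖ ≤ M / m * (L * B) := by
  have hB0 : 0 ≤ B := (norm_nonneg _).trans (hB 0)
  have hM0 : 0 ≤ M := (norm_nonneg _).trans (hM 0)
  set n := ⌊x / L⌋
  obtain ⟨y, hx⟩ : ∃ y, x = y + n * L := ⟨x - n * L, by ring⟩
  have hy0 : 0 ≤ y := by have := floor_mul_le hL x; linarith
  have hy1 : y ≤ L := by have := lt_floor_mul_add hL x; linarith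
  have h5 : ‖∫ t in (0 : ℝ)..y, H t‖ ≤ B * y := by
    have := intervalIntegral.norm_integral_le_of_norm_le_const (a := 0) (b := y)
      (f := H) (C := B) (fun t _ => hB t)
    rwa [sub_zero, abs_of_nonneg hy0] at this
  have h6 : ‖∫ t in y..L, H t‖ ≤ B * (L - y) := by
    have := intervalIntegral.norm_integral_le_of_norm_le_const (a := y) (b := L)
      (f := H) (C := B) (fun t _ => hB t)
    rwa [abs_of_nonneg (sub_nonneg.2 hy1)] at this
  have h7 : ‖1 - z‖⁻¹ ≤ m⁻¹ := inv_anti₀ hm hmz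
  rw [hx, integral_quasiPeriodic_eq hH hi hz hz0, norm_mul, norm_inv]
  have h8 : ‖(1 - z ^ (n + 1)) * (∫ t in (0 : ℝ)..y, H t) + (1 - z ^ n) * ∫ t in y..L, H t‖
      ≤ M * (B * y) + M * (B * (L - y)) := by
    refine (norm_add_le _ _).trans ?_
    rw [norm_mul, norm_mul]
    exact add_le_add (mul_le_mul (hM _) h5 (norm_nonneg _) hM0)
      (mul_le_mul (hM _) h6 (norm_nonneg _) hM0)
  calc _ ≤ m⁻¹ * (M * (B * y) + M * (B * (L - y))) :=
        mul_le_mul h7 h8 (norm_nonneg _) (by positivity)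
    _ = _ := by ring

end

/-! ### Levels of b-adic cells and iterated primitives at one level -/

/-- The primitive, vanishing at `0` and `1`, of `K` minus its mean over `[0, 1]`. -/
def prim (K : ℝ → ℂ) (x : ℝ) : ℂ := ∫ t in (0 : ℝ)..x, (K t - ∫ s in (0 : ℝ)..1, K s)

/-- The length `b ^ (-a)` of the elementary intervals of level `a`. -/
def cell (b a : ℕ) : ℝ := ((b : ℝ) ^ a)⁻¹

/-- The product of the step characters of the levels in `l`. -/
def charProd (b : ℕ) (z : ℕ → ℂ) (l : List ℕ) (x : ℝ) : ℂ :=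
  (l.map fun a => stepChar (z a) (cell b a) x).prod

theorem cell_pos {b : ℕ} (hb : 2 ≤ b) (a : ℕ) : 0 < cell b a := by
  have : (0 : ℝ) < b := by exact_mod_cast (by omega : 0 < b)
  simp only [cell]; positivity

theorem exists_cell_eq {b : ℕ} (hb : 2 ≤ b) {a a' : ℕ} (h : a' < a) :
    ∃ n : ℕ, cell b a' = n * (b * cell b a) := by
  have h0 : (b : ℝ) ≠ 0 := by exact_mod_cast (by omega : b ≠ 0)
  refine ⟨b ^ (a - a' - 1), ?_⟩
  obtain ⟨d, rfl⟩ : ∃ d, a = a' + 1 + d := ⟨a - a' - 1, by omega⟩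
  have : a' + 1 + d - a' - 1 = d := by omega
  simp only [cell, this]
  push_cast
  field_simp
  ring

theorem cell_zero (b : ℕ) : cell b 0 = 1 := by simp [cell]

theorem cell_mul_le {b : ℕ} (hb : 2 ≤ b) {a a' : ℕ} (h : a' < a) :
    b * cell b a ≤ cell b a' := by
  obtain ⟨n, hn⟩ := exists_cell_eq hb h
  have hp := cell_pos hb a
  have hp' := cell_pos hb a'
  have h0 : (0 : ℝ) < b := by exact_mod_cast (by omega : 0 < b)
  have : n ≠ 0 := by rintro rfl; simp at hn; linarith
  have : (1 : ℝ) ≤ n := by exact_mod_cast Nat.one_le_iff_ne_zero.2 this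
  rw [hn]
  nlinarith [mul_pos h0 hp]

theorem CellConst.of_mul {L : ℝ} (n : ℕ) {h : ℝ → ℂ} (hh : CellConst (n * L) h) :
    CellConst L h := by
  intro x y hxy
  apply hh
  have key : ∀ x : ℝ, ⌊x / (n * L)⌋ = ⌊x / L⌋ / (n : ℤ) := by
    intro x
    rw [mul_comm, ← div_div, Int.floor_div_natCast]
  rw [key, key, hxy]

theorem charProd_cellConst {b : ℕ} (hb : 2 ≤ b) (z : ℕ → ℂ) {a : ℕ} {l : List ℕ}
    (hl : ∀ x ∈ l, x < a) : CellConst (b * cell b a) (charProd b z l) := by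
  intro x y hxy
  unfold charProd
  congr 1
  apply List.map_congr_left
  intro a' ha'
  obtain ⟨n, hn⟩ := exists_cell_eq hb (hl a' ha')
  have := stepChar_cellConst (z a') (cell b a')
  rw [hn] at this
  rw [hn]
  exact this.of_mul n x y hxy

theorem charProd_cons (b : ℕ) (z : ℕ → ℂ) (a : ℕ) (l : List ℕ) (x : ℝ) :
    charProd b z (a :: l) x = stepChar (z a) (cell b a) x * charProd b z l x := by
  simp [charProd]

theorem measurable_charProd (b : ℕ) (z : ℕ → ℂ) (l : List ℕ) : Measurable (charProd b z l) := by
  induction l with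
  | nil =>
    have : charProd b z [] = fun _ => 1 := by ext; simp [charProd]
    rw [this]
    exact measurable_const
  | cons a l ih =>
    have : charProd b z (a :: l) = fun x => stepChar (z a) (cell b a) x * charProd b z l x :=
      funext (charProd_cons b z a l)
    rw [this]
    exact (measurable_stepChar _ _).mul ih

theorem norm_charProd {b : ℕ} {z : ℕ → ℂ} {l : List ℕ} (hz : ∀ a ∈ l, ‖z a‖ = 1) (x : ℝ) :
    ‖charProd b z l x‖ = 1 := by
  induction l with
  | nil => simp [charProd]
  | cons a l ih =>
    rw [charProd_cons, norm_mul, norm_stepChar (hz a (by simp)), one_mul]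
    exact ih fun a ha => hz a (by simp [ha])

/-- `z ≠ 1` is a `b`-th root of unity. -/
structure IsRoot (b : ℕ) (z : ℂ) : Prop where
  pow_eq : z ^ b = 1
  ne_one : z ≠ 1

theorem IsRoot.norm_eq {b : ℕ} (hb : 2 ≤ b) {z : ℂ} (h : IsRoot b z) : ‖z‖ = 1 :=
  Complex.norm_eq_one_of_pow_eq_one h.pow_eq (by omega)

theorem IsRoot.ne_zero {b : ℕ} (hb : 2 ≤ b) {z : ℂ} (h : IsRoot b z) : z ≠ 0 := by
  intro h0; have := h.norm_eq hb; simp [h0] at this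

/-- `F` is a continuous quasi-periodic function of level `a`. -/
structure IsLevel (b a : ℕ) (z : ℂ) (F : ℝ → ℂ) : Prop where
  root : IsRoot b z
  cont : Continuous F
  quasi : QuasiPeriodic (cell b a) z F

theorem IsLevel.locInt {b a : ℕ} {z : ℂ} {F : ℝ → ℂ} (h : IsLevel b a z F) : LocInt F :=
  fun s t => h.cont.intervalIntegrable s t

theorem IsLevel.integral_cell {b a a' : ℕ} (hb : 2 ≤ b) {z : ℂ} {F : ℝ → ℂ} (h : IsLevel b a z F)
    (ha : a' < a) (s : ℝ) : ∫ x in s..(s + cell b a'), F x = 0 := by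
  obtain ⟨n, hn⟩ := exists_cell_eq hb ha
  rw [hn]
  exact h.quasi.integral_eq_zero h.root.ne_one h.root.pow_eq n s

theorem LocInt.continuous_integral {H : ℝ → ℂ} (h : LocInt H) :
    Continuous fun x => ∫ t in (0 : ℝ)..x, H t :=
  intervalIntegral.continuous_primitive h 0

theorem LocInt.continuous_qpPrim {H : ℝ → ℂ} (h : LocInt H) (L : ℝ) (z : ℂ) :
    Continuous (qpPrim L z H) :=
  h.continuous_integral.sub continuous_const

theorem prim_add_const {b a : ℕ} (hb : 2 ≤ b) (ha : 1 ≤ a) {z : ℂ} {F : ℝ → ℂ}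
    (h : IsLevel b a z F) (μ : ℂ) (x : ℝ) :
    prim (fun t => μ + F t) x = ∫ t in (0 : ℝ)..x, F t := by
  have h1 : ∫ s in (0 : ℝ)..1, F s = 0 := by
    have := h.integral_cell hb (a' := 0) (by omega) 0
    rwa [cell_zero, zero_add] at this
  have h2 : ∫ s in (0 : ℝ)..1, (μ + F s) = μ := by
    rw [intervalIntegral.integral_add (by simp) (h.locInt _ _), h1]; simp
  simp only [prim, h2, add_sub_cancel_left]

theorem exists_prim_eq {b a : ℕ} (hb : 2 ≤ b) (ha : 1 ≤ a) {z : ℂ} {F : ℝ → ℂ}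
    (h : IsLevel b a z F) (μ : ℂ) {m B : ℝ} (hm : 0 < m) (hmz : m ≤ ‖1 - z‖)
    (hB : ∀ x, ‖F x‖ ≤ B) :
    ∃ (μ' : ℂ) (F' : ℝ → ℂ), IsLevel b a z F' ∧ prim (fun t => μ + F t) = (fun t => μ' + F' t) ∧
      ∀ x, ‖F' x‖ ≤ cell b a * B / m := by
  refine ⟨(1 - z)⁻¹ * ∫ t in (0 : ℝ)..cell b a, F t, qpPrim (cell b a) z F,
    ⟨h.root, h.locInt.continuous_qpPrim _ _,
      qpPrim_quasiPeriodic h.quasi h.locInt h.root.ne_one⟩, ?_,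
    norm_qpPrim_le h.quasi h.locInt h.root.ne_one (cell_pos hb a) hm hmz hB⟩
  ext x
  rw [prim_add_const hb ha h]
  simp [qpPrim]

/-- All primitives but the last are replaced by quasi-periodic ones plus a constant, which the next
`prim` discards. Only the last must start at 0, so the factor M enters once. -/
theorem norm_iterate_prim_le {b a : ℕ} (hb : 2 ≤ b) (ha : 1 ≤ a) {z : ℂ} {m M : ℝ} (hm : 0 < m)
    (hmz : m ≤ ‖1 - z‖) (hM : ∀ n : ℤ, ‖1 - z ^ n‖ ≤ M) (n : ℕ) :
    ∀ {F : ℝ → ℂ} {B : ℝ} (μ : ℂ), IsLevel b a z F → (∀ x, ‖F x‖ ≤ B) →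
      ∀ x, ‖prim^[n + 1] (fun t => μ + F t) x‖ ≤ M * B * (cell b a / m) ^ (n + 1) := by
  induction n with
  | zero =>
    intro F B μ h hB x
    rw [zero_add, Function.iterate_one, prim_add_const hb ha h]
    refine (norm_integral_quasiPeriodic_le h.quasi h.locInt h.root.ne_one (h.root.ne_zero hb)
      (cell_pos hb a) hm hmz hM hB x).trans (le_of_eq ?_)
    ring
  | succ n ih =>
    intro F B μ h hB x
    obtain ⟨μ', F', h', he, hB'⟩ := exists_prim_eq hb ha h μ hm hmz hB
    rw [Function.iterate_succ, Function.comp_apply, he]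
    refine (ih μ' h' hB' x).trans (le_of_eq ?_)
    ring

/-! ### One step: multiplication by a coarser character and integration -/

section step
variable {b a a' : ℕ} {z z' : ℂ} {F : ℝ → ℂ}

theorem quasiPeriodic_stepChar_mul (hb : 2 ≤ b) (ha : a' < a) (h : IsLevel b a z F)
    (hz' : IsRoot b z') (μ : ℂ) :
    QuasiPeriodic (cell b a') z' fun x => stepChar z' (cell b a') x * (μ + F x) := by
  intro x
  obtain ⟨n, hn⟩ := exists_cell_eq hb ha
  have h1 : F (x + cell b a') = F x := by rw [hn]; exact h.quasi.periodic h.root.pow_eq n x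
  simp only [h1, stepChar_quasiPeriodic (hz'.ne_zero hb) (cell_pos hb a') x]
  ring

theorem locInt_stepChar_mul (hb : 2 ≤ b) (h : IsLevel b a z F)
    (hz' : IsRoot b z') (μ : ℂ) (L : ℝ) :
    LocInt fun x => stepChar z' L x * (μ + F x) :=
  LocInt.bdd_mul (fun s t => (continuous_const.add h.cont).intervalIntegrable s t)
    (measurable_stepChar _ _) (fun x => (norm_stepChar (hz'.norm_eq hb) L x).le)

/-- Integrating against the step character of a coarser level, the later factors come out. -/
theorem prim_stepChar_mul (hb : 2 ≤ b) (ha : a' < a) (ha' : 1 ≤ a') (h : IsLevel b a z F)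
    (hz' : IsRoot b z') (μ : ℂ) {ζ : ℕ → ℂ} {l : List ℕ} (hl : ∀ x ∈ l, x < a')
    (hζ : ∀ x ∈ l, ‖ζ x‖ = 1) :
    prim (fun x => stepChar z' (cell b a') x * (μ + F x) * charProd b ζ l x) =
      fun x => (∫ t in (0 : ℝ)..x, stepChar z' (cell b a') t * (μ + F t)) * charProd b ζ l x := by
  have hi := locInt_stepChar_mul hb h hz' μ (cell b a')
  have hq := quasiPeriodic_stepChar_mul hb ha h hz' μ
  have hi2 : LocInt fun x => charProd b ζ l x * (stepChar z' (cell b a') x * (μ + F x)) :=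
    hi.bdd_mul (measurable_charProd b ζ l) (fun x => (norm_charProd hζ x).le)
  have hpos : 0 < b * cell b a' := by
    have : (0 : ℝ) < b := by exact_mod_cast (by omega : 0 < b)
    exact mul_pos this (cell_pos hb a')
  -- The cells have the length of a full period: the integrand has mean zero on each of them, and
  -- the strictly coarser characters are constant there.
  have key := integral_cellConst_mul hi hi2 hpos (charProd_cellConst hb ζ hl) (fun s => by
    have := hq.integral_eq_zero hz'.ne_one hz'.pow_eq 1 s
    rwa [Nat.cast_one, one_mul] at this)
  have h1 : ∫ t in (0 : ℝ)..1, stepChar z' (cell b a') t * (μ + F t) = 0 := by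
    obtain ⟨n, hn⟩ := exists_cell_eq hb (show 0 < a' by omega)
    have := hq.integral_eq_zero hz'.ne_one hz'.pow_eq n 0
    rwa [← hn, cell_zero, zero_add] at this
  have h2 : ∀ x, ∫ t in (0 : ℝ)..x, stepChar z' (cell b a') t * (μ + F t) * charProd b ζ l t
      = charProd b ζ l x * ∫ t in (0 : ℝ)..x, stepChar z' (cell b a') t * (μ + F t) := by
    intro x
    rw [← key]
    congr 1
    ext t
    ring
  ext x
  simp only [prim, h2 1, h1, mul_zero, sub_zero, h2 x]
  ring

theorem integral_stepChar_mul_eq (hb : 2 ≤ b) (ha : a' < a) (h : IsLevel b a z F)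
    (hz' : IsRoot b z') (μ : ℂ) (x : ℝ) :
    ∫ t in (0 : ℝ)..x, stepChar z' (cell b a') t * (μ + F t) =
      (∫ t in (0 : ℝ)..x, stepChar z' (cell b a') t * μ) +
        stepChar z' (cell b a') x * ∫ t in (0 : ℝ)..x, F t := by
  have hi : LocInt fun x => stepChar z' (cell b a') x * F x := by
    simpa using! locInt_stepChar_mul hb h hz' 0 (cell b a')
  have hi0 : LocInt fun x => stepChar z' (cell b a') x * μ :=
    LocInt.bdd_mul (fun s t => by simp) (measurable_stepChar _ _)
      (fun x => (norm_stepChar (hz'.norm_eq hb) _ x).le)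
  rw [← integral_cellConst_mul h.locInt hi (cell_pos hb a') (stepChar_cellConst _ _)
    (h.integral_cell hb ha), ← intervalIntegral.integral_add (hi0 _ _) (hi _ _)]
  simp_rw [mul_add]

theorem integral_cell_stepChar_mul {H : ℝ → ℂ} (hb : 2 ≤ b) :
    ∫ t in (0 : ℝ)..cell b a', stepChar z' (cell b a') t * H t =
      ∫ t in (0 : ℝ)..cell b a', H t := by
  apply intervalIntegral.integral_congr_ae
  have : ∀ᵐ y : ℝ, y ≠ cell b a' := by simp [ae_iff]
  filter_upwards [this] with y hy hmem
  rw [uIoc_of_le (cell_pos hb a').le] at hmem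
  rw [stepChar_eq_one _ hmem.1.le (lt_of_le_of_ne hmem.2 hy), one_mul]

/-- The part coming from F is integrated at the finer level a before the character is put back, so
it carries `cell b a` instead of `cell b a'`. The last bound, on the whole of μ' + F', is kept
separately because adding the bounds of μ' and F' would be too weak when m is small. -/
theorem exists_step (hb : 2 ≤ b) (ha : a' < a) (h : IsLevel b a z F)
    (hz' : IsRoot b z') (μ : ℂ) {m M B : ℝ} (hm : 0 < m) (hmz : m ≤ ‖1 - z‖)
    (hM : ∀ n : ℤ, ‖1 - z ^ n‖ ≤ M) (hmz' : m ≤ ‖1 - z'‖) (hM' : ∀ n : ℤ, ‖1 - z' ^ n‖ ≤ M)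
    (hB : ∀ x, ‖F x‖ ≤ B) :
    ∃ (μ' : ℂ) (F' : ℝ → ℂ), IsLevel b a' z' F' ∧
      (∀ x, ∫ t in (0 : ℝ)..x, stepChar z' (cell b a') t * (μ + F t) = μ' + F' x) ∧
      μ' = (1 - z')⁻¹ * (cell b a' * μ) ∧
      (∀ x, ‖F' x‖ ≤ cell b a' * ‖μ‖ / m + M / m * (cell b a * B)) ∧
      ∀ x, ‖μ' + F' x‖ ≤ M / m * (cell b a' * ‖μ‖) + M / m * (cell b a * B) := by
  have hi := locInt_stepChar_mul hb h hz' μ (cell b a')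
  have hq := quasiPeriodic_stepChar_mul hb ha h hz' μ
  have hI : ∫ t in (0 : ℝ)..cell b a', stepChar z' (cell b a') t * (μ + F t) = cell b a' * μ := by
    have := h.integral_cell hb ha 0
    rw [zero_add] at this
    rw [integral_cell_stepChar_mul hb, intervalIntegral.integral_add (by simp) (h.locInt _ _), this]
    simp
  have hI0 : ∫ t in (0 : ℝ)..cell b a', stepChar z' (cell b a') t * μ = cell b a' * μ := by
    rw [integral_cell_stepChar_mul hb]
    simp
  have hi0 : LocInt fun x => stepChar z' (cell b a') x * μ :=
    LocInt.bdd_mul (fun s t => by simp) (measurable_stepChar _ _)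
      (fun x => (norm_stepChar (hz'.norm_eq hb) _ x).le)
  have hq0 : QuasiPeriodic (cell b a') z' fun x => stepChar z' (cell b a') x * μ := by
    intro x
    simp only [stepChar_quasiPeriodic (hz'.ne_zero hb) (cell_pos hb a') x]
    ring
  have hB0 : ∀ x, ‖stepChar z' (cell b a') x * μ‖ ≤ ‖μ‖ := by
    intro x
    rw [norm_mul, norm_stepChar (hz'.norm_eq hb), one_mul]
  have hE : ∀ x, ‖stepChar z' (cell b a') x * ∫ t in (0 : ℝ)..x, F t‖ ≤ M / m * (cell b a * B) := by
    intro x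
    rw [norm_mul, norm_stepChar (hz'.norm_eq hb), one_mul]
    exact norm_integral_quasiPeriodic_le h.quasi h.locInt h.root.ne_one (h.root.ne_zero hb)
      (cell_pos hb a) hm hmz hM hB x
  have hW : ∀ x, ∫ t in (0 : ℝ)..x, stepChar z' (cell b a') t * (μ + F t) =
      (1 - z')⁻¹ * (cell b a' * μ) + qpPrim (cell b a') z'
        (fun x => stepChar z' (cell b a') x * (μ + F x)) x := by
    intro x
    simp only [qpPrim, hI]
    ring
  refine ⟨_, _, ⟨hz', hi.continuous_qpPrim _ _, qpPrim_quasiPeriodic hq hi hz'.ne_one⟩, hW, rfl,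
    ?_, ?_⟩
  · intro x
    have : qpPrim (cell b a') z' (fun x => stepChar z' (cell b a') x * (μ + F x)) x =
        qpPrim (cell b a') z' (fun x => stepChar z' (cell b a') x * μ) x +
          stepChar z' (cell b a') x * ∫ t in (0 : ℝ)..x, F t := by
      simp only [qpPrim, hI, hI0, integral_stepChar_mul_eq hb ha h hz']
      ring
    rw [this]
    exact (norm_add_le _ _).trans (add_le_add
      (norm_qpPrim_le hq0 hi0 hz'.ne_one (cell_pos hb a') hm hmz' hB0 x) (hE x))
  · intro x
    rw [← hW, integral_stepChar_mul_eq hb ha h hz']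
    exact (norm_add_le _ _).trans (add_le_add
      (norm_integral_quasiPeriodic_le hq0 hi0 hz'.ne_one (hz'.ne_zero hb)
      (cell_pos hb a') hm hmz' hM' hB0 x) (hE x))

end step

/-! ### The iterated primitive in a general base -/

/-- The sum of the first `n` entries of `l`, continued by repeating its last entry (`a`, if `l` is
empty). -/
def levelSum : ℕ → List ℕ → ℕ → ℕ
  | 0, _, _ => 0
  | n + 1, [], a => a + levelSum n [] a
  | n + 1, a' :: l, _ => a' + levelSum n l a'

theorem levelSum_nil (n a : ℕ) : levelSum n [] a = n * a := by
  induction n with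
  | zero => simp [levelSum]
  | succ n ih => rw [levelSum, ih]; ring

theorem cell_add (b x y : ℕ) : cell b (x + y) = cell b x * cell b y := by
  simp only [cell, pow_add, mul_inv]

theorem cell_mul (b n x : ℕ) : cell b (n * x) = cell b x ^ n := by
  simp only [cell, inv_pow, ← pow_mul, mul_comm]

/-- `z` is a root of unity as above, with lower bound `m` and upper bound `M` for the distances
from `1` of its powers. -/
structure IsBoundedRoot (b : ℕ) (m M : ℝ) (z : ℂ) : Prop extends IsRoot b z where
  le_norm : m ≤ ‖1 - z‖
  norm_le : ∀ n : ℤ, ‖1 - z ^ n‖ ≤ M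

theorem charProd_nil (b : ℕ) (ζ : ℕ → ℂ) (x : ℝ) : charProd b ζ [] x = 1 := by simp [charProd]

/-- Induction on the number of primitives, where i counts the characters already absorbed. The scale
A becomes A `cell b a'` / m at each step, and G i bounds the size of F relative to A. `hGm` serves
only when the characters run out. -/
theorem norm_iterate_prim_charProd_le {b : ℕ} (hb : 2 ≤ b) {m M : ℝ} (hm : 0 < m) (hM : 0 ≤ M)
    (hmb : 1 ≤ m * b) {G : ℕ → ℝ} (hG0 : ∀ i, 0 ≤ G i) (hG : ∀ i, G (i + 1) = 1 + M / b * G i)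
    (hGmono : Monotone G) (hGm : ∀ i, G i ≤ 1 + m * G i) {ζ : ℕ → ℂ} (n : ℕ) :
    ∀ (l : List ℕ) (i a : ℕ) (z μ : ℂ) (F : ℝ → ℂ) (A : ℝ), IsLevel b a z F →
      IsBoundedRoot b m M z → (a :: l).Pairwise (· > ·) → (∀ x ∈ a :: l, 1 ≤ x) →
      (∀ x ∈ l, IsBoundedRoot b m M (ζ x)) → 0 ≤ A → ‖μ‖ ≤ A → (∀ x, ‖F x‖ ≤ A * G i) →
      (∀ x, ‖μ + F x‖ ≤ A * (M + M * m * G i)) →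
      ∀ x, ‖prim^[n] (fun x => (μ + F x) * charProd b ζ l x) x‖ ≤
        A * cell b (levelSum n l a) / m ^ n * (M * (1 + m * G (i + l.length))) := by
  have hb0 : (0 : ℝ) < b := by exact_mod_cast (by omega : 0 < b)
  induction n with
  | zero =>
    intro l i a z μ F A hF hz hl hl1 hζ hA hμ hFB hW x
    -- Characters may be left over here; raising the index to the total count makes the bound
    -- independent of where the iteration stops.
    have h1 : G i ≤ G (i + l.length) := hGmono (by omega)
    rw [Function.iterate_zero, id, norm_mul, norm_charProd fun x hx => (hζ x hx).norm_eq hb,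
      levelSum, cell_zero]
    calc _ ≤ A * (M + M * m * G i) * 1 := by gcongr; exact hW x
      _ ≤ A * (M + M * m * G (i + l.length)) * 1 := by gcongr
      _ = _ := by ring
  | succ n ih =>
    intro l i a z μ F A hF hz hl hl1 hζ hA hμ hFB hW x
    cases l with
    | nil =>
      simp only [charProd_nil, mul_one, List.length_nil, add_zero, levelSum_nil, cell_mul]
      refine (norm_iterate_prim_le hb (hl1 a (by simp)) hm hz.le_norm hz.norm_le n μ hF hFB
        x).trans ?_
      have hc := cell_pos hb a
      calc _ = A * (cell b a / m) ^ (n + 1) * (M * G i) := by ring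
        _ ≤ A * (cell b a / m) ^ (n + 1) * (M * (1 + m * G i)) := by
          gcongr; exact hGm i
        _ = _ := by rw [div_pow]; ring
    | cons a' l =>
      rw [List.pairwise_cons] at hl
      have haa : a' < a := hl.1 a' (by simp)
      have hl' := List.pairwise_cons.1 hl.2
      have hz' := hζ a' (by simp)
      obtain ⟨μ', F', hF', hW', hμ', hB', hC'⟩ := exists_step hb haa hF hz'.toIsRoot μ hm
        hz.le_norm hz.norm_le hz'.le_norm hz'.norm_le hFB
      have hc := cell_pos hb a
      have hc' := cell_pos hb a'
      -- Consecutive levels differ by at least a factor b; this is the source of the ratio M / b in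
      -- the recursion of G.
      have hcc : cell b a ≤ cell b a' / b := by
        rw [le_div_iff₀ hb0, mul_comm]; exact cell_mul_le hb haa
      have hbm : 1 / b ≤ m := by rwa [div_le_iff₀ hb0]
      have hGi := hG0 i
      have hcG : M / m * (cell b a * (A * G i)) ≤ M / m * (cell b a' / b * (A * G i)) := by
        gcongr
      have hGs : G i ≤ G (i + 1) := hGmono (by omega)
      have hp : prim (fun x => (μ + F x) * charProd b ζ (a' :: l) x) =
          fun x => (μ' + F' x) * charProd b ζ l x := by
        have h1 : (fun x => (μ + F x) * charProd b ζ (a' :: l) x) =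
            fun x => stepChar (ζ a') (cell b a') x * (μ + F x) * charProd b ζ l x := by
          ext x
          rw [charProd_cons]
          ring
        rw [h1, prim_stepChar_mul hb haa (hl1 a' (by simp)) hF hz'.toIsRoot μ hl'.1
          (fun x hx => (hζ x (by simp [hx])).norm_eq hb)]
        ext x
        rw [hW']
      rw [Function.iterate_succ, Function.comp_apply, hp]
      refine (ih l (i + 1) a' (ζ a') μ' F' (A * cell b a' / m) hF' hz' hl.2
        (fun x hx => hl1 x (List.mem_cons_of_mem _ hx)) (fun x hx => hζ x (by simp [hx]))
        (by positivity) ?_ (fun x => (hB' x).trans ?_) (fun x => (hC' x).trans ?_) x).trans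
        (le_of_eq ?_)
      · rw [hμ', norm_mul, norm_mul, norm_inv, Complex.norm_real, Real.norm_of_nonneg hc'.le]
        have := inv_anti₀ hm hz'.le_norm
        calc _ ≤ m⁻¹ * (cell b a' * A) := by gcongr
          _ = _ := by ring
      · calc _ ≤ cell b a' * A / m + M / m * (cell b a' / b * (A * G i)) := by gcongr
          _ = _ := by rw [hG]; ring
      · calc _ ≤ M / m * (cell b a' * A) + M / m * (cell b a' / b * (A * G i)) := by gcongr
          _ = A * cell b a' / m * (M + M * (1 / b) * G i) := by ring
          _ ≤ _ := by gcongr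
      · rw [levelSum, cell_add, List.length_cons, pow_succ, add_right_comm i 1, add_assoc]
        field_simp

/-! ### The iterated primitive in base 2 -/

theorem IsLevel.continuous_re {a : ℕ} {z μ : ℂ} {F : ℝ → ℂ} (hF : IsLevel 2 a z F) {w : ℝ → ℝ}
    (hw : ∀ x, μ + F x = w x) : Continuous w := by
  have : w = fun x => (μ + F x).re := by ext x; simp [hw]
  rw [this]
  exact Complex.continuous_re.comp (continuous_const.add hF.cont)

/-- In base `2` the property of taking real values in `[0, 2 A]` is preserved. -/
theorem exists_binary_step {a a' : ℕ} (ha : a' < a) {F : ℝ → ℂ} {A : ℝ}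
    (hF : IsLevel 2 a (-1) F) (hr : IsRoot 2 (-1)) {w : ℝ → ℝ} (hw : ∀ x, (A : ℂ) + F x = w x)
    (hw0 : ∀ x, 0 ≤ w x) (x : ℝ) :
    ∃ r : ℝ, ∫ t in (0 : ℝ)..x, stepChar (-1) (cell 2 a') t * (A + F t) = r ∧ 0 ≤ r ∧
      r ≤ A * cell 2 a' := by
  have hb : 2 ≤ 2 := le_rfl
  set L := cell 2 a'
  have hL : 0 < L := cell_pos hb a'
  have hwc : Continuous w := hF.continuous_re hw
  have hi := locInt_stepChar_mul hb hF hr A L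
  have hq := quasiPeriodic_stepChar_mul hb ha hF hr A
  have hwi : ∀ s t, IntervalIntegrable w volume s t := fun s t => hwc.intervalIntegrable s t
  have hI : ∫ t in (0 : ℝ)..L, w t = A * L := by
    have h1 : ∫ t in (0 : ℝ)..L, ((w t : ℝ) : ℂ) = A * L := by
      simp_rw [← hw]
      have := hF.integral_cell hb ha 0
      rw [zero_add] at this
      rw [intervalIntegral.integral_add (by simp) (hF.locInt _ _), this]
      simp [mul_comm]
    rw [intervalIntegral.integral_ofReal] at h1
    exact_mod_cast h1
  set n := ⌊x / L⌋
  obtain ⟨y, hx⟩ : ∃ y, x = y + n * L := ⟨x - n * L, by ring⟩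
  have hy0 : 0 ≤ y := by have := floor_mul_le hL x; linarith
  have hy1 : y < L := by have := lt_floor_mul_add hL x; linarith
  have h5 : ∀ s t, 0 ≤ s → s ≤ t → t ≤ L →
      ∫ t in s..t, stepChar (-1) L t * (A + F t) = ((∫ t in s..t, w t : ℝ) : ℂ) := by
    intro s t hs hst ht
    rw [← intervalIntegral.integral_ofReal]
    apply intervalIntegral.integral_congr_ae
    have : ∀ᵐ y : ℝ, y ≠ L := by simp [ae_iff]
    filter_upwards [this] with u hu hmem
    rw [uIoc_of_le hst] at hmem
    rw [stepChar_eq_one _ (hs.trans hmem.1.le) (lt_of_le_of_ne (hmem.2.trans ht) hu), one_mul, hw]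
  have h6 : (∫ t in (0 : ℝ)..y, w t) + ∫ t in y..L, w t = A * L := by
    rw [intervalIntegral.integral_add_adjacent_intervals (hwi _ _) (hwi _ _), hI]
  have h7 : 0 ≤ ∫ t in (0 : ℝ)..y, w t :=
    intervalIntegral.integral_nonneg hy0 fun t _ => hw0 t
  have h8 : 0 ≤ ∫ t in y..L, w t :=
    intervalIntegral.integral_nonneg hy1.le fun t _ => hw0 t
  rw [hx, integral_quasiPeriodic_eq hq hi hr.ne_one (hr.ne_zero hb), h5 0 y le_rfl hy0 hy1.le,
    h5 y L hy0 hy1.le le_rfl, zpow_add₀ (by norm_num), zpow_one]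
  -- The primitive is a zigzag: it climbs from 0 to A L over even cells and descends back to 0 over
  -- odd ones.
  rcases Int.even_or_odd n with he | ho
  · refine ⟨∫ t in (0 : ℝ)..y, w t, ?_, h7, by linarith⟩
    rw [he.neg_one_zpow]
    norm_num
    ring
  · refine ⟨∫ t in y..L, w t, ?_, h8, by linarith⟩
    rw [ho.neg_one_zpow]
    norm_num
    ring

/-- Here A is the constant part itself. One step turns it into A L / 2, with L the new cell length,
while the new values fill at most [0, A L]; so the range [0, 2 A] reproduces itself. -/
theorem norm_iterate_prim_charProd_two_le (hr : IsRoot 2 (-1)) (n : ℕ) :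
    ∀ (l : List ℕ) (a : ℕ) (F : ℝ → ℂ) (A : ℝ) (w : ℝ → ℝ), IsLevel 2 a (-1) F →
      (a :: l).Pairwise (· > ·) → (∀ x ∈ a :: l, 1 ≤ x) → 0 ≤ A →
      (∀ x, (A : ℂ) + F x = w x) → (∀ x, 0 ≤ w x) → (∀ x, w x ≤ 2 * A) →
      ∀ x, ‖prim^[n] (fun x => (A + F x) * charProd 2 (fun _ => -1) l x) x‖ ≤
        2 * A * cell 2 (levelSum n l a) / 2 ^ n := by
  have hb : 2 ≤ 2 := le_rfl
  induction n with
  | zero =>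
    intro l a F A w hF hl hl1 hA hw hw0 hw2 x
    rw [Function.iterate_zero, id, norm_mul, norm_charProd (by simp), levelSum, cell_zero, hw,
      Complex.norm_real, Real.norm_of_nonneg (hw0 x)]
    linarith [hw2 x]
  | succ n ih =>
    intro l a F A w hF hl hl1 hA hw hw0 hw2 x
    cases l with
    | nil =>
      simp only [charProd_nil, mul_one, levelSum_nil, cell_mul]
      have hFB : ∀ x, ‖F x‖ ≤ A := by
        intro x
        have : F x = ((w x - A : ℝ) : ℂ) := by push_cast; rw [← hw]; ring
        rw [this, Complex.norm_real, Real.norm_eq_abs, abs_le]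
        constructor <;> linarith [hw0 x, hw2 x]
      refine (norm_iterate_prim_le hb (hl1 a (by simp)) (m := 2) (M := 2) two_pos
        (by norm_num) (fun n => ?_) n A hF hFB x).trans (le_of_eq ?_)
      · rcases Int.even_or_odd n with he | ho
        · rw [he.neg_one_zpow]; norm_num
        · rw [ho.neg_one_zpow]; norm_num
      · rw [div_pow]; ring
    | cons a' l =>
      rw [List.pairwise_cons] at hl
      have haa : a' < a := hl.1 a' (by simp)
      have hl' := List.pairwise_cons.1 hl.2
      have hFB : ∀ x, ‖F x‖ ≤ A := by
        intro x
        have : F x = ((w x - A : ℝ) : ℂ) := by push_cast; rw [← hw]; ring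
        rw [this, Complex.norm_real, Real.norm_eq_abs, abs_le]
        constructor <;> linarith [hw0 x, hw2 x]
      have hM : ∀ n : ℤ, ‖1 - (-1 : ℂ) ^ n‖ ≤ 2 := by
        intro n
        rcases Int.even_or_odd n with he | ho
        · rw [he.neg_one_zpow]; norm_num
        · rw [ho.neg_one_zpow]; norm_num
      have hm : (2 : ℝ) ≤ ‖1 - (-1 : ℂ)‖ := by norm_num
      -- Only the decomposition and the value of μ' are needed; the norm bounds are superseded by
      -- the range invariant.
      obtain ⟨μ', F', hF', hW', hμ', -, -⟩ := exists_step hb haa hF hr A two_pos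
        hm hM hm hM hFB
      have hc' := cell_pos hb a'
      have hμ2 : μ' = ((A * cell 2 a' / 2 : ℝ) : ℂ) := by
        rw [hμ']; push_cast; norm_num; ring
      choose w' hw1' hw2' hw3' using exists_binary_step haa hF hr hw hw0
      have hp : prim (fun x => (A + F x) * charProd 2 (fun _ => -1) (a' :: l) x) =
          fun x => (μ' + F' x) * charProd 2 (fun _ => -1) l x := by
        have h1 : (fun x => (A + F x) * charProd 2 (fun _ => -1) (a' :: l) x) =
            fun x => stepChar (-1) (cell 2 a') x * (A + F x) * charProd 2 (fun _ => -1) l x := by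
          ext x
          rw [charProd_cons]
          ring
        rw [h1, prim_stepChar_mul hb haa (hl1 a' (by simp)) hF hr A hl'.1 (by simp)]
        ext x
        rw [hW']
      rw [Function.iterate_succ, Function.comp_apply, hp, hμ2]
      refine (ih l a' F' (A * cell 2 a' / 2) w' hF' hl.2
        (fun x hx => hl1 x (List.mem_cons_of_mem _ hx)) (by positivity) (fun x => ?_) hw2'
        (fun x => ?_) x).trans (le_of_eq ?_)
      · rw [← hμ2, ← hW', hw1']
      · linarith [hw3' x]
      · rw [levelSum, cell_add]
        field_simp
        ring

/-! ### Integration by parts -/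

theorem integral_mul_eq_neg_integral_deriv_mul {f u : ℝ → ℝ}
    (hf : AbsolutelyContinuousOnInterval f 0 1) (hu : IntervalIntegrable u volume 0 1)
    (hu0 : ∫ x in (0 : ℝ)..1, u x = 0) :
    ∫ x in (0 : ℝ)..1, f x * u x =
      -∫ x in (0 : ℝ)..1, deriv f x * ∫ t in (0 : ℝ)..x, u t := by
  have h := hf.integral_mul_deriv_eq_deriv_mul
    (hu.absolutelyContinuousOnInterval_intervalIntegral (c := 0) (by simp))
  simp only [hu0, intervalIntegral.integral_same, mul_zero, sub_zero, zero_sub] at h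
  rw [← h]
  apply intervalIntegral.integral_congr_ae
  filter_upwards [hu.ae_hasDerivAt_integral] with x hx hmem
  rw [(hx (uIoc_subset_uIcc hmem) 0 (by simp)).deriv]

theorem intervalIntegrable_ofReal {u : ℝ → ℝ} {s t : ℝ} (hu : IntervalIntegrable u volume s t) :
    IntervalIntegrable (fun x => (u x : ℂ)) volume s t :=
  ⟨hu.1.ofReal, hu.2.ofReal⟩

theorem integral_ofReal_mul_eq_neg {f : ℝ → ℝ} {K : ℝ → ℂ}
    (hf : AbsolutelyContinuousOnInterval f 0 1) (hK : IntervalIntegrable K volume 0 1)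
    (hK0 : ∫ x in (0 : ℝ)..1, K x = 0) :
    ∫ x in (0 : ℝ)..1, (f x : ℂ) * K x =
      -∫ x in (0 : ℝ)..1, ((deriv f x : ℝ) : ℂ) * ∫ t in (0 : ℝ)..x, K t := by
  have hre : IntervalIntegrable (fun x => (K x).re) volume 0 1 := ⟨hK.1.re, hK.2.re⟩
  have him : IntervalIntegrable (fun x => (K x).im) volume 0 1 := ⟨hK.1.im, hK.2.im⟩
  have key : ∀ {g : ℝ → ℝ} {H : ℝ → ℂ}, IntervalIntegrable (fun x => g x * (H x).re) volume 0 1 →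
      IntervalIntegrable (fun x => g x * (H x).im) volume 0 1 →
      ∫ x in (0 : ℝ)..1, (g x : ℂ) * H x = ((∫ x in (0 : ℝ)..1, g x * (H x).re : ℝ) : ℂ) +
        Complex.I * ((∫ x in (0 : ℝ)..1, g x * (H x).im : ℝ) : ℂ) := by
    intro g H h1 h2
    rw [← intervalIntegral.integral_ofReal, ← intervalIntegral.integral_ofReal,
      ← intervalIntegral.integral_const_mul,
      ← intervalIntegral.integral_add (intervalIntegrable_ofReal h1)
        ((intervalIntegrable_ofReal h2).const_mul _)]
    congr 1
    ext x
    conv_lhs => rw [← Complex.re_add_im (H x)]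
    push_cast
    ring
  have hprim : ∀ x ∈ uIcc (0 : ℝ) 1, ∫ t in (0 : ℝ)..x, K t =
      ((∫ t in (0 : ℝ)..x, (K t).re : ℝ) : ℂ) +
        Complex.I * ((∫ t in (0 : ℝ)..x, (K t).im : ℝ) : ℂ) := by
    intro x hx
    have hs : uIcc 0 x ⊆ uIcc (0 : ℝ) 1 := uIcc_subset_uIcc left_mem_uIcc hx
    rw [← intervalIntegral.integral_ofReal, ← intervalIntegral.integral_ofReal,
      ← intervalIntegral.integral_const_mul, ← intervalIntegral.integral_add
        (intervalIntegrable_ofReal (hre.mono_set hs))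
        ((intervalIntegrable_ofReal (him.mono_set hs)).const_mul _)]
    congr 1
    ext t
    conv_lhs => rw [← Complex.re_add_im (K t)]
    ring
  have hpre : ∀ x ∈ uIcc (0 : ℝ) 1, (∫ t in (0 : ℝ)..x, K t).re = ∫ t in (0 : ℝ)..x, (K t).re :=
    fun x hx => by rw [hprim x hx]; simp
  have hpim : ∀ x ∈ uIcc (0 : ℝ) 1, (∫ t in (0 : ℝ)..x, K t).im = ∫ t in (0 : ℝ)..x, (K t).im :=
    fun x hx => by rw [hprim x hx]; simp
  have hre0 := hpre 1 (by simp)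
  have him0 := hpim 1 (by simp)
  rw [hK0] at hre0 him0
  have hc : ContinuousOn (fun x => ∫ t in (0 : ℝ)..x, K t) (uIcc 0 1) :=
    intervalIntegral.continuousOn_primitive_interval ((intervalIntegrable_iff' (by simp)).1 hK)
  have hd := hf.intervalIntegrable_deriv
  rw [key (hre.continuousOn_mul hf.continuousOn) (him.continuousOn_mul hf.continuousOn),
    key (hd.mul_continuousOn (Complex.continuous_re.comp_continuousOn hc))
      (hd.mul_continuousOn (Complex.continuous_im.comp_continuousOn hc)),
    integral_mul_eq_neg_integral_deriv_mul hf hre hre0.symm,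
    integral_mul_eq_neg_integral_deriv_mul hf him him0.symm]
  have e1 : ∫ x in (0 : ℝ)..1, deriv f x * (∫ t in (0 : ℝ)..x, K t).re =
      ∫ x in (0 : ℝ)..1, deriv f x * ∫ t in (0 : ℝ)..x, (K t).re :=
    intervalIntegral.integral_congr fun x hx => by simp only [hpre x hx]
  have e2 : ∫ x in (0 : ℝ)..1, deriv f x * (∫ t in (0 : ℝ)..x, K t).im =
      ∫ x in (0 : ℝ)..1, deriv f x * ∫ t in (0 : ℝ)..x, (K t).im :=
    intervalIntegral.integral_congr fun x hx => by simp only [hpim x hx]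
  rw [e1, e2]
  push_cast
  ring

/-- The mean of K may be subtracted because `der i f` has mean zero. The primitive then vanishes at
both 0 and 1, so no boundary term survives. -/
theorem integral_der_mul {α : ℕ} {f : ℝ → ℝ} (hf : IsSobolevPer α f) {i : ℕ} (hi : i < α)
    {K : ℝ → ℂ} (hK : IntervalIntegrable K volume 0 1) :
    ∫ x in (0 : ℝ)..1, (der i f x : ℂ) * K x =
      -∫ x in (0 : ℝ)..1, (der (i + 1) f x : ℂ) * prim K x := by
  have hac := hf.absolutelyContinuous i hi
  set e := ∫ s in (0 : ℝ)..1, K s with he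
  have hKe : IntervalIntegrable (fun x => K x - e) volume 0 1 := hK.sub (by simp)
  have h0 : ∫ x in (0 : ℝ)..1, (K x - e) = 0 := by
    rw [intervalIntegral.integral_sub hK (by simp), ← he]; simp
  have hint : IntervalIntegrable (fun x => (der i f x : ℂ)) volume 0 1 :=
    (Complex.continuous_ofReal.comp_continuousOn hac.continuousOn).intervalIntegrable
  have h1 : ∫ x in (0 : ℝ)..1, (der i f x : ℂ) * K x =
      ∫ x in (0 : ℝ)..1, (der i f x : ℂ) * (K x - e) := by
    have hp : IntervalIntegrable (fun x => (der i f x : ℂ) * K x) volume 0 1 :=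
      hK.continuousOn_mul (Complex.continuous_ofReal.comp_continuousOn hac.continuousOn)
    simp_rw [mul_sub]
    rw [intervalIntegral.integral_sub hp (hint.mul_const e),
      intervalIntegral.integral_mul_const, intervalIntegral.integral_ofReal,
      hf.integral_eq_zero i hi]
    simp
  rw [h1, integral_ofReal_mul_eq_neg hac hKe h0]
  congr 1
  apply intervalIntegral.integral_congr_ae
  have : ∀ᵐ y : ℝ, y ≠ 1 := by simp [ae_iff]
  filter_upwards [this] with x hx hmem
  rw [uIoc_of_le zero_le_one] at hmem
  -- The derivative within [0, 1] is the ordinary one at interior points, hence almost everywhere.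
  have : der (i + 1) f x = deriv (der i f) x := by
    rw [der, iteratedDerivWithin_succ]
    exact derivWithin_of_mem_nhds (Icc_mem_nhds hmem.1 (lt_of_le_of_ne hmem.2 hx))
  rw [this]
  rfl

theorem intervalIntegrable_prim {K : ℝ → ℂ} (hK : IntervalIntegrable K volume 0 1) :
    IntervalIntegrable (prim K) volume 0 1 := by
  have h : IntervalIntegrable (fun x => K x - ∫ s in (0 : ℝ)..1, K s) volume 0 1 :=
    hK.sub (by simp)
  have hc : ContinuousOn (prim K) (uIcc 0 1) :=
    intervalIntegral.continuousOn_primitive_interval ((intervalIntegrable_iff' (by simp)).1 h)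
  exact hc.intervalIntegrable

theorem norm_integral_mul_eq {α : ℕ} {f : ℝ → ℝ} (hf : IsSobolevPer α f) (n : ℕ) :
    ∀ (i : ℕ) (K : ℝ → ℂ), i + n = α → IntervalIntegrable K volume 0 1 →
      ‖∫ x in (0 : ℝ)..1, (der i f x : ℂ) * K x‖ =
        ‖∫ x in (0 : ℝ)..1, (der α f x : ℂ) * prim^[n] K x‖ := by
  induction n with
  | zero => rintro i K rfl -; rfl
  | succ n ih =>
    intro i K hi hK
    rw [integral_der_mul hf (by omega) hK, norm_neg, ih (i + 1) _ (by omega)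
      (intervalIntegrable_prim hK), Function.iterate_succ, Function.comp_apply]

theorem norm_integral_mul_le {α : ℕ} {f : ℝ → ℝ} (hf : IsSobolevPer α f) {K : ℝ → ℂ}
    (hK : IntervalIntegrable K volume 0 1) {B : ℝ} (hB : ∀ x, ‖prim^[α] K x‖ ≤ B) :
    ‖∫ x in (0 : ℝ)..1, (f x : ℂ) * K x‖ ≤ (∫ x in (0 : ℝ)..1, |der α f x|) * B := by
  have h := norm_integral_mul_eq hf α 0 K (zero_add α) hK
  simp only [der, iteratedDerivWithin_zero] at h
  rw [h, ← intervalIntegral.integral_mul_const]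
  have hi : IntervalIntegrable (der α f) volume 0 1 := by
    rw [intervalIntegrable_iff_integrableOn_Icc_of_le zero_le_one]
    exact hf.memLp.integrable one_le_two
  refine intervalIntegral.norm_integral_le_of_norm_le zero_le_one ?_ (hi.abs.mul_const B)
  refine Filter.Eventually.of_forall fun x _ => ?_
  rw [norm_mul, Complex.norm_real, Real.norm_eq_abs]
  exact mul_le_mul_of_nonneg_left (hB x) (abs_nonneg _)

/-! ### Positions of the digits and the exponent μ -/

theorem sum_Icc_pred (g : ℕ → ℕ) (n : ℕ) :
    ∑ i ∈ Finset.Icc 1 n, g (i - 1) = ∑ i ∈ Finset.range n, g i := by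
  induction n with
  | zero => simp
  | succ n ih =>
    rw [Finset.sum_Icc_succ_top (by omega), ih, Finset.sum_range_succ]
    simp

theorem levelSum_eq_of_length_le (n : ℕ) : ∀ (l : List ℕ) (a : ℕ), l.length ≤ n →
    levelSum n l a = (∑ i ∈ Finset.range l.length, l.getD i 0) + (n - l.length) * l.getLastD a := by
  induction n with
  | zero =>
    intro l a h
    have : l = [] := List.length_eq_zero_iff.1 (by omega)
    simp [this, levelSum]
  | succ n ih =>
    intro l a h
    cases l with
    | nil => simp [levelSum_nil]
    | cons a' l =>
      rw [levelSum, ih l a' (by simpa using h), List.length_cons, Finset.sum_range_succ']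
      simp only [List.getD_cons_succ, List.getD_cons_zero, List.getLastD_cons,
        Nat.add_sub_add_right]
      ring

theorem levelSum_eq_of_le_length (n : ℕ) : ∀ (l : List ℕ) (a : ℕ), n ≤ l.length →
    levelSum n l a = ∑ i ∈ Finset.range n, l.getD i 0 := by
  induction n with
  | zero => simp [levelSum]
  | succ n ih =>
    intro l a h
    cases l with
    | nil => simp at h
    | cons a' l =>
      rw [levelSum, ih l a' (by simpa using h), Finset.sum_range_succ']
      simp only [List.getD_cons_succ, List.getD_cons_zero]
      ring

/-- The positions of the nonzero digits, in decreasing order. -/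
def positionList (b k : ℕ) : List ℕ := (positions b k).sort (· ≥ ·)

theorem length_positionList (b k : ℕ) : (positionList b k).length = hammingWeight b k :=
  Finset.length_sort _

theorem mem_positionList {b k a : ℕ} : a ∈ positionList b k ↔ a ∈ positions b k :=
  Finset.mem_sort _

theorem positions_nonempty {b k : ℕ} (hk : 1 ≤ k) : (positions b k).Nonempty := by
  have hk0 : k ≠ 0 := by omega
  have hd : b.digits k ≠ [] := Nat.digits_ne_nil_iff_ne_zero.2 hk0
  have hlen : 0 < (b.digits k).length := List.length_pos_iff.2 hd
  refine ⟨(b.digits k).length, ?_⟩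
  rw [positions, Finset.mem_filter, Finset.mem_Icc]
  refine ⟨⟨hlen, le_rfl⟩, ?_⟩
  have h := Nat.getLast_digit_ne_zero b hk0
  rw [List.getLast_eq_getElem] at h
  rwa [natDigit, List.getD_eq_getElem _ _ (by omega)]

theorem levelSum_positionList {b k : ℕ} (hk : 1 ≤ k) (n a : ℕ) :
    levelSum n (positionList b k) a = muPer b n k := by
  have hne : hammingWeight b k ≠ 0 := (Finset.card_pos.2 (positions_nonempty hk)).ne'
  have hl := length_positionList b k
  rw [muPer, if_neg (by omega)]
  have hs : ∀ m, ∑ i ∈ Finset.Icc 1 m, position b k i =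
      ∑ i ∈ Finset.range m, (positionList b k).getD i 0 := fun m => by
    rw [← sum_Icc_pred]; rfl
  split_ifs with h
  · rw [levelSum_eq_of_length_le n _ a (by omega), hs, hl]
    congr 2
    have hn : positionList b k ≠ [] := by
      intro h0; rw [h0] at hl; exact hne hl.symm
    rw [List.getLastD_eq_getLast?, List.getLast?_eq_getLast_of_ne_nil hn, Option.getD_some,
      List.getLast_eq_getElem]
    change _ = (positionList b k).getD (hammingWeight b k - 1) 0
    rw [List.getD_eq_getElem _ _ (by omega)]
    congr 1
    omega
  · rw [levelSum_eq_of_le_length n _ a (by omega), hs]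

/-! ### Walsh functions as products of step characters -/

theorem natDigit_mem {b k a : ℕ} (hb : 2 ≤ b) (ha : a ∈ positions b k) :
    natDigit b k a ∈ Icc 1 (b - 1) := by
  simp only [positions, Finset.mem_filter, Finset.mem_Icc] at ha
  have h2 : natDigit b k a < b := by
    rw [natDigit, List.getD_eq_getElem _ _ (by omega)]
    exact Nat.digits_lt_base (by omega) (List.getElem_mem _)
  simp only [mem_Icc]
  omega

theorem isPrimitiveRoot_conj_omega {b : ℕ} (hb : 2 ≤ b) :
    IsPrimitiveRoot (conj (omega b)) b :=
  (Complex.isPrimitiveRoot_exp b (by omega)).map_of_injective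
    (f := starRingEnd ℂ) (starRingEnd ℂ).injective

theorem conj_wal_eq {b : ℕ} (hb : 2 ≤ b) (k : ℕ) {x : ℝ} (hx : 0 ≤ x) :
    conj (wal b k x) =
      charProd b (fun a => conj (omega b) ^ natDigit b k a) (positionList b k) x := by
  have h1 := (isPrimitiveRoot_conj_omega hb).pow_eq_one
  rw [charProd, positionList, ← List.prod_toFinset _ (Finset.sort_nodup _ _),
    Finset.sort_toFinset, wal, map_pow, ← Finset.prod_pow_eq_pow_sum]
  refine Finset.prod_congr rfl fun a _ => ?_
  have hf : ⌊x / cell b a⌋ = (⌊x * (b : ℝ) ^ a⌋₊ : ℤ) := by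
    rw [cell, div_inv_eq_mul, Int.natCast_floor_eq_floor (by positivity)]
  rw [stepChar, hf, zpow_natCast, realDigit, pow_mul]
  -- The digit is a floor reduced mod b, and a b-th root of unity does not see the reduction.
  refine (pow_eq_pow_mod _ ?_).symm
  rw [← pow_mul, mul_comm, pow_mul, h1, one_pow]

theorem norm_coeff_le {b α k : ℕ} (hb : 2 ≤ b) {f : ℝ → ℝ} (hf : IsSobolevPer α f) {B : ℝ}
    (hB : ∀ x, ‖prim^[α] (charProd b (fun a => conj (omega b) ^ natDigit b k a)
      (positionList b k)) x‖ ≤ B) :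
    ‖coeff b k (fun x => (f x : ℂ))‖ ≤ (∫ x in (0 : ℝ)..1, |der α f x|) * B := by
  set K := charProd b (fun a => conj (omega b) ^ natDigit b k a) (positionList b k)
  have hn : ∀ x, ‖K x‖ = 1 := norm_charProd fun a _ => by
    rw [norm_pow, (isPrimitiveRoot_conj_omega hb).norm'_eq_one (by omega), one_pow]
  have hK : IntervalIntegrable K volume 0 1 := by
    have := LocInt.bdd_mul (F := fun _ => 1) (fun s t => by simp) (measurable_charProd b
      (fun a => conj (omega b) ^ natDigit b k a) (positionList b k)) (fun x => (hn x).le) 0 1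
    simpa using this
  have : coeff b k (fun x => (f x : ℂ)) = ∫ x in (0 : ℝ)..1, (f x : ℂ) * K x := by
    rw [intervalIntegral.integral_of_le zero_le_one, integral_Ioc_eq_integral_Ioo,
      ← integral_Ico_eq_integral_Ioo]
    exact setIntegral_congr_fun measurableSet_Ico fun x hx => by
      simp only [conj_wal_eq hb k hx.1]; rfl
  rw [this]
  exact norm_integral_mul_le hf hK hB

/-! ### The constants m_b, M_b and the geometric sum -/

theorem finite_dist (b : ℕ) :
    ((fun c : ℕ => ‖1 - conj (omega b) ^ c‖) '' Icc 1 (b - 1)).Finite :=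
  (finite_Icc _ _).image _

theorem isBoundedRoot {b c : ℕ} (hb : 2 ≤ b) (hc : c ∈ Icc 1 (b - 1)) :
    IsBoundedRoot b (mConst b) (MConst b) (conj (omega b) ^ c) := by
  have hp := isPrimitiveRoot_conj_omega hb
  have hM : ∀ c ∈ Icc 1 (b - 1), ‖1 - conj (omega b) ^ c‖ ≤ MConst b := fun c hc =>
    le_csSup (finite_dist b).bddAbove (mem_image_of_mem _ hc)
  refine ⟨⟨?_, fun h => ?_⟩, csInf_le (finite_dist b).bddBelow (mem_image_of_mem _ hc),
    fun n => ?_⟩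
  · rw [← pow_mul, mul_comm, pow_mul, hp.pow_eq_one, one_pow]
  · have := Nat.le_of_dvd hc.1 ((hp.pow_eq_one_iff_dvd c).1 h)
    have := hc.2
    omega
  · have hb0 : (0 : ℤ) < b := by omega
    have h0 := Int.emod_nonneg ((c : ℤ) * n) hb0.ne'
    have h1 := Int.emod_lt_of_pos ((c : ℤ) * n) hb0
    have : (conj (omega b) ^ c) ^ n = conj (omega b) ^ (((c : ℤ) * n) % b).toNat := by
      rw [← zpow_natCast (conj (omega b)) c, ← zpow_mul, ← zpow_natCast _ (Int.toNat _),
        Int.toNat_of_nonneg h0]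
      conv_lhs => rw [← Int.mul_ediv_add_emod ((c : ℤ) * n) b]
      rw [zpow_add₀ (hp.ne_zero (by omega)), zpow_mul, zpow_natCast _ b, hp.pow_eq_one, one_zpow,
        one_mul]
    rw [this]
    rcases Nat.eq_zero_or_pos (((c : ℤ) * n) % b).toNat with h | h
    · rw [h, pow_zero, sub_self, norm_zero]
      exact (norm_nonneg _).trans (hM c hc)
    · exact hM _ ⟨h, by omega⟩

theorem sum_one_sub_pow {b : ℕ} {z : ℂ} (h : IsRoot b z) :
    ∑ j ∈ Finset.range b, (1 - z ^ j) = b := by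
  have h1 : (1 - z) * ∑ j ∈ Finset.range b, z ^ j = 0 := by
    rw [mul_neg_geom_sum, h.pow_eq, sub_self]
  have h2 := (mul_eq_zero.1 h1).resolve_left (sub_ne_zero.2 h.ne_one.symm)
  rw [Finset.sum_sub_distrib, h2]
  simp

/-- The numbers 1 - z ^ j, j < b, sum to b, and each has norm at most j ‖1 - z‖; hence b ≤ ‖1 - z‖ b
(b - 1) / 2. -/
theorem IsRoot.two_le_mul_norm {b : ℕ} (hb : 2 ≤ b) {z : ℂ} (h : IsRoot b z) :
    2 ≤ b * ‖1 - z‖ := by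
  have hn := h.norm_eq hb
  have h1 : ∀ j ∈ Finset.range b, ‖1 - z ^ j‖ ≤ ‖1 - z‖ * j := by
    intro j _
    rw [← mul_neg_geom_sum, norm_mul]
    gcongr
    refine (norm_sum_le _ _).trans ?_
    simp [hn]
  have h2 : (b : ℝ) ≤ ‖1 - z‖ * ∑ j ∈ Finset.range b, (j : ℝ) := by
    have h3 := norm_sum_le (Finset.range b) fun j => 1 - z ^ j
    rw [sum_one_sub_pow h, Complex.norm_natCast] at h3
    rw [Finset.mul_sum]
    exact h3.trans (Finset.sum_le_sum h1)
  have h4 : (∑ j ∈ Finset.range b, (j : ℝ)) * 2 ≤ b * b := by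
    have := Finset.sum_range_id_mul_two b
    have h5 : b * (b - 1) ≤ b * b := Nat.mul_le_mul_left _ (by omega)
    rw [← this] at h5
    have h6 := Nat.cast_le (α := ℝ).2 h5
    push_cast at h6
    exact h6
  have hb0 : (0 : ℝ) < b := by exact_mod_cast (by omega : 0 < b)
  have h6 : (b : ℝ) * 2 ≤ b * (b * ‖1 - z‖) := by nlinarith [norm_nonneg (1 - z)]
  exact le_of_mul_le_mul_left h6 hb0

/-- The average of 1 - z ^ j over j < b is 1, so these numbers cannot all have norm below 1. -/
theorem IsBoundedRoot.one_le {b : ℕ} (hb : 2 ≤ b) {m M : ℝ} {z : ℂ} (h : IsBoundedRoot b m M z) :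
    1 ≤ M := by
  have h3 := norm_sum_le (Finset.range b) fun j => 1 - z ^ j
  rw [sum_one_sub_pow h.toIsRoot, Complex.norm_natCast] at h3
  have h4 : ∑ j ∈ Finset.range b, ‖1 - z ^ j‖ ≤ ∑ j ∈ Finset.range b, M :=
    Finset.sum_le_sum fun j _ => by simpa using h.norm_le j
  rw [Finset.sum_const, Finset.card_range, nsmul_eq_mul] at h4
  have hb0 : (0 : ℝ) < b := by exact_mod_cast (by omega : 0 < b)
  nlinarith

theorem two_le_mul_mConst {b : ℕ} (hb : 2 ≤ b) : 2 ≤ b * mConst b := by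
  obtain ⟨c, hc, he⟩ := Set.Nonempty.csInf_mem
    (show ((fun c : ℕ => ‖1 - conj (omega b) ^ c‖) '' Icc 1 (b - 1)).Nonempty from
      ⟨_, mem_image_of_mem _ (mem_Icc.2 ⟨le_refl 1, by omega⟩)⟩) (finite_dist b)
  rw [mConst, ← he]
  exact (isBoundedRoot hb hc).toIsRoot.two_le_mul_norm hb

theorem MConst_le_two {b : ℕ} (hb : 2 ≤ b) : MConst b ≤ 2 := by
  apply csSup_le ⟨_, mem_image_of_mem _ (mem_Icc.2 ⟨le_refl 1, by omega⟩)⟩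
  rintro _ ⟨c, -, rfl⟩
  refine (norm_sub_le _ _).trans ?_
  rw [norm_one, norm_pow, (isPrimitiveRoot_conj_omega hb).norm'_eq_one (by omega), one_pow]
  norm_num

/-- The geometric sum `∑_{j < i} (M_b / b) ^ j`. -/
def geomSum (b i : ℕ) : ℝ := ∑ j ∈ Finset.range i, (MConst b / b) ^ j

theorem MConst_pos {b : ℕ} (hb : 2 ≤ b) : 0 < MConst b :=
  zero_lt_one.trans_le ((isBoundedRoot hb (c := 1) ⟨le_rfl, by omega⟩).one_le hb)

theorem geomSum_succ (b i : ℕ) : geomSum b (i + 1) = 1 + MConst b / b * geomSum b i := by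
  rw [geomSum, geom_sum_succ, add_comm]; rfl

theorem geomSum_nonneg {b : ℕ} (hb : 2 ≤ b) (i : ℕ) : 0 ≤ geomSum b i :=
  Finset.sum_nonneg fun _ _ => pow_nonneg (div_nonneg (MConst_pos hb).le (Nat.cast_nonneg b)) _

theorem geomSum_mono {b : ℕ} (hb : 2 ≤ b) : Monotone (geomSum b) := fun _ _ h =>
  Finset.sum_le_sum_of_subset_of_nonneg (Finset.range_mono h)
    fun _ _ _ => pow_nonneg (div_nonneg (MConst_pos hb).le (Nat.cast_nonneg b)) _

theorem geomSum_le {b : ℕ} (hb : 2 ≤ b) (i : ℕ) : geomSum b i ≤ 1 + mConst b * geomSum b i := by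
  have hb0 : (2 : ℝ) ≤ b := by exact_mod_cast hb
  have hm := two_le_mul_mConst hb
  have hM := MConst_le_two hb
  -- The ratio is at most 2 / b, so the sum is at most b / (b - 2), written so that b = 2 is
  -- allowed. With m_b ≥ 2 / b this gives (1 - m_b) G ≤ 1.
  have key : (b - 2) * geomSum b i ≤ b := by
    induction i with
    | zero => simp [geomSum]
    | succ i ih =>
      have h0 := geomSum_nonneg hb i
      have h1 : MConst b / b * ((b - 2) * geomSum b i) ≤ 2 / b * b := by
        gcongr
      rw [div_mul_cancel₀ _ (by positivity)] at h1
      rw [geomSum_succ]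
      linarith
  have h0 := geomSum_nonneg hb i
  nlinarith

theorem geomSum_eq {b : ℕ} (hb : 2 < b) (i : ℕ) :
    mConst b * geomSum b i =
      b * mConst b / (b - MConst b) * (1 - (MConst b / b) ^ i) := by
  have hM := MConst_le_two hb.le
  have hb0 : (2 : ℝ) < b := by exact_mod_cast hb
  have hbM : (b : ℝ) - MConst b ≠ 0 := by linarith
  have hb1 : (b : ℝ) ≠ 0 := by linarith
  have hq : MConst b / b ≠ 1 := by
    intro h
    rw [div_eq_one_iff_eq hb1] at h
    exact hbM (by rw [h, sub_self])
  have h := mul_neg_geom_sum (MConst b / b : ℝ) i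
  rw [← h, geomSum]
  field_simp

/-! ### Bounds for the iterated primitives of Walsh functions -/

theorem norm_iterate_prim_conj_wal_le {b α k : ℕ} (hb : 2 ≤ b) (hk : 1 ≤ k) (x : ℝ) :
    ‖prim^[α] (charProd b (fun a => conj (omega b) ^ natDigit b k a) (positionList b k)) x‖ ≤
      cell b (muPer b α k) / mConst b ^ α *
        (MConst b * (1 + mConst b * geomSum b (hammingWeight b k))) := by
  have hb0 : (0 : ℝ) < b := by exact_mod_cast (by omega : 0 < b)
  have hm := two_le_mul_mConst hb
  have hroot := isBoundedRoot hb (c := 1) ⟨le_rfl, by omega⟩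
  -- The start is μ = 1, F = 0, A = 1 and i = 0, at a fictitious level finer than every digit
  -- position. The zero function is quasi-periodic for any multiplier, so any admissible root will
  -- do.
  have h := norm_iterate_prim_charProd_le hb (m := mConst b) (M := MConst b)
    (pos_of_mul_pos_right (by linarith) hb0.le) (MConst_pos hb).le (by linarith)
    (geomSum_nonneg hb)
    (geomSum_succ b) (geomSum_mono hb) (geomSum_le hb)
    (ζ := fun a => conj (omega b) ^ natDigit b k a) α (positionList b k) 0
    ((Nat.digits b k).length + 1) _ 1 (fun _ => 0) 1
    ⟨hroot.toIsRoot, continuous_const, fun x => by simp⟩ hroot ?_ ?_ ?_ zero_le_one (by simp)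
    (by simp [geomSum]) (by simpa [geomSum] using hroot.one_le hb) x
  · simpa [levelSum_positionList hk, length_positionList] using h
  · refine List.pairwise_cons.2 ⟨fun a ha => ?_, (Finset.sortedGT_sort _).pairwise⟩
    simp only [mem_positionList, positions, Finset.mem_filter, Finset.mem_Icc] at ha
    omega
  · intro a ha
    rcases List.mem_cons.1 ha with rfl | ha
    · omega
    · simp only [mem_positionList, positions, Finset.mem_filter, Finset.mem_Icc] at ha
      omega
  · exact fun a ha => isBoundedRoot hb (natDigit_mem hb (mem_positionList.1 ha))

theorem conj_omega_two : conj (omega 2) = -1 := by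
  have : 2 * (Real.pi : ℂ) * Complex.I / (2 : ℕ) = Real.pi * Complex.I := by push_cast; ring
  rw [omega, this, Complex.exp_pi_mul_I]
  simp

theorem norm_iterate_prim_conj_wal_two_le {α k : ℕ} (hk : 1 ≤ k) (x : ℝ) :
    ‖prim^[α] (charProd 2 (fun a => conj (omega 2) ^ natDigit 2 k a) (positionList 2 k)) x‖ ≤
      2 * cell 2 (muPer 2 α k) / 2 ^ α := by
  have hr : IsRoot 2 (-1) := ⟨by norm_num, by norm_num⟩
  have he : charProd 2 (fun a => conj (omega 2) ^ natDigit 2 k a) (positionList 2 k) =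
      charProd 2 (fun _ => -1) (positionList 2 k) := by
    ext x
    unfold charProd
    congr 1
    apply List.map_congr_left
    intro a ha
    have := natDigit_mem le_rfl (mem_positionList.1 ha)
    have : natDigit 2 k a = 1 := le_antisymm this.2 this.1
    simp only [this, pow_one, conj_omega_two]
  have h := norm_iterate_prim_charProd_two_le hr α (positionList 2 k)
    ((Nat.digits 2 k).length + 1) (fun _ => 0) 1 (fun _ => 1)
    ⟨hr, continuous_const, fun x => by simp⟩ ?_ ?_ zero_le_one (by simp) (by simp) (by simp) x
  · rw [he]
    simpa [levelSum_positionList hk] using h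
  · refine List.pairwise_cons.2 ⟨fun a ha => ?_, (Finset.sortedGT_sort _).pairwise⟩
    simp only [mem_positionList, positions, Finset.mem_filter, Finset.mem_Icc] at ha
    omega
  · intro a ha
    rcases List.mem_cons.1 ha with rfl | ha
    · omega
    · simp only [mem_positionList, positions, Finset.mem_filter, Finset.mem_Icc] at ha
      omega

theorem cell_eq_zpow (b n : ℕ) : cell b n = (b : ℝ) ^ (-(n : ℤ)) := by
  rw [cell, zpow_neg, zpow_natCast]

end Walsh

end

theorem mainTheorem7 (b α k : ℕ) (hb : 2 ≤ b) (hα : 1 ≤ α) (hk : 1 ≤ k)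
    (f : ℝ → ℝ) (hf : Walsh.IsSobolevPer α f) :
    (2 < b →
      ‖Walsh.coeff b k (fun x => (f x : ℂ))‖ ≤
        (∫ x in (0 : ℝ)..1, |Walsh.der α f x|) *
          ((b : ℝ) ^ (-(Walsh.muPer b α k : ℤ)) / Walsh.mConst b ^ α) *
          (Walsh.MConst b *
            (1 + (b : ℝ) * Walsh.mConst b / ((b : ℝ) - Walsh.MConst b) *
              (1 - (Walsh.MConst b / (b : ℝ)) ^ Walsh.hammingWeight b k)))) ∧
    (b = 2 →
      ‖Walsh.coeff b k (fun x => (f x : ℂ))‖ ≤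
        (∫ x in (0 : ℝ)..1, |Walsh.der α f x|) *
          ((2 : ℝ) ^ (-(Walsh.muPer b α k : ℤ)) / (2 : ℝ) ^ (α - 1))) := by
  refine ⟨fun hb2 => ?_, ?_⟩
  · have h := Walsh.norm_coeff_le hb hf
      (Walsh.norm_iterate_prim_conj_wal_le (α := α) hb hk)
    rwa [Walsh.geomSum_eq hb2, Walsh.cell_eq_zpow, ← mul_assoc] at h
  · rintro rfl
    have h := Walsh.norm_coeff_le hb hf (Walsh.norm_iterate_prim_conj_wal_two_le (α := α) hk)
    rw [Walsh.cell_eq_zpow] at h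
    refine h.trans (le_of_eq ?_)
    obtain ⟨n, rfl⟩ : ∃ n, α = n + 1 := ⟨α - 1, by omega⟩
    rw [Nat.add_sub_cancel, pow_succ]
    push_cast
    field_simp
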